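/- Let $\mathcal X$ be a finite set with $N\ge 1$ elements. Let $\mathcal R_N$ be the set of $N\times N$ Markov transition (row-stochastic) matrices $P$ on $\mathcal X$ that are reversible with respect to some probability distribution $\pi$ with $\pi(x)>0$ for all $x$ (that is, $\pi(x)P(x,y)=\pi(y)P(y,x)$ for all $x,y$), and let $\overline{\mathcal R_N}$ be its closure in $\mathbb R^{N^2}$. For probability distributions $\mu,\nu$ on $\mathcal X$ the separation distance is $$d_{\rm sep}(\mu,\nu)=\max_{x:\,\nu(x)>0}\Bigl[1-\frac{\mu(x)}{\nu(x)}\Bigr].$$ Let $P\in\overline{\mathcal R_N}$ be reversible with respect to a probability distribution $\pi$ on $\mathcal X$ (possibly with $\pi(x)=0$ for some $x$), and suppose that the eigenvalues of $P$, listed with algebraic multiplicity, are real and satisfy $0\le\beta_1\le\cdots\le\beta_{N-1}<\beta_N=1$. Let $\tau_1,\dots,\tau_{N-1}$ be independent geometric random variables with means $1/(1-\beta_j)$, i.e. $\mathbb P(\tau_j=t)=\beta_j^{t-1}(1-\beta_j)$ for $t\ge1$ (with $0^0=1$). Let $\mu$ be any probability distribution on $\mathcal X$. Then: (i) for every integer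 $t\ge0$, $$d_{\rm sep}(\mu P^t,\pi)\le\mathbb P(\tau_1+\cdots+\tau_{N-1}>t);$$ (ii) there are a probability space carrying a Markov chain $(X_t)_{t\ge0}$ with initial distribution $\mu$ and transition matrix $P$, and a strong stationary time $T$ for it with the same law as $\tau_1+\cdots+\tau_{N-1}$. Here $T$ is a strong stationary time if it is a randomized stopping time (a stopping time of a filtration relative to which $(X_t)$ is a Markov chain with transition matrix $P$) and $\mathbb P(X_T=x,\ T=t)=\pi(x)\,\mathbb P(T=t)$ for all $t\ge0$ and $x\in\mathcal X$. -/

import Mathlib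

open MeasureTheory ProbabilityTheory

noncomputable section

namespace MarkovSep

/-- Detailed balance: `π(x) P(x,y) = π(y) P(y,x)` for all `x`, `y`. -/
def IsReversible {S : Type*} (P : Matrix S S ℝ) (π : S → ℝ) : Prop :=
  ∀ x y, π x * P x y = π y * P y x

/-- Markov transition matrices on `S` that are reversible with respect to a probability
distribution charging every state. -/
def reversibleClass (S : Type*) [Fintype S] [DecidableEq S] : Set (Matrix S S ℝ) :=
  {P | P ∈ Matrix.rowStochastic ℝ S ∧
    ∃ π ∈ stdSimplex ℝ S, (∀ x, 0 < π x) ∧ IsReversible P π}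

/-- Separation distance `max_x [1 - μ(x)/ν(x)]`. States with `ν(x) = 0` do not contribute to
the maximum (the ratio is read as `+∞` there). The maximum is over a finite set, nonempty when `ν`
is a probability distribution. -/
def dsep {S : Type*} [Fintype S] (μ ν : S → ℝ) : ℝ :=
  ⨆ x : {x : S // ν x ≠ 0}, (1 - μ x / ν x)

/-- `X` is a Markov chain with initial distribution `μ` and transition matrix `P`, relative to
the filtration `ℱ` (which may be larger than the one generated by `X`). -/
structure IsMarkovChain {S Ω : Type*} [MeasurableSpace Ω] (ρ : Measure Ω)
    (ℱ : Filtration ℕ (inferInstance : MeasurableSpace Ω))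
    (μ : S → ℝ) (P : Matrix S S ℝ) (X : ℕ → Ω → S) : Prop where
  adapted : ∀ t x, MeasurableSet[ℱ t] {ω | X t ω = x}
  initial : ∀ x, ρ.real {ω | X 0 ω = x} = μ x
  markov : ∀ t x y A, MeasurableSet[ℱ t] A →
    ρ.real (A ∩ {ω | X t ω = x ∧ X (t + 1) ω = y}) =
      ρ.real (A ∩ {ω | X t ω = x}) * P x y

/-- `τ` is a (finite) strong stationary time for the chain `X`: a randomized stopping time, i.e.
a stopping time of the filtration `ℱ` relative to which `X` is Markov, with
`Prob(X_τ = x | τ = t) = π(x)` for every `x` and every `t` (written without division). -/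
structure IsStrongStationaryTime {S Ω : Type*} [MeasurableSpace Ω] (ρ : Measure Ω)
    (ℱ : Filtration ℕ (inferInstance : MeasurableSpace Ω))
    (π : S → ℝ) (X : ℕ → Ω → S) (τ : Ω → ℕ) : Prop where
  stopping : IsStoppingTime ℱ (fun ω => (τ ω : WithTop ℕ))
  stationary : ∀ t x,
    ρ.real {ω | X (τ ω) ω = x ∧ τ ω = t} = π x * ρ.real {ω | τ ω = t}

end MarkovSep

end

section

open MeasureTheory ProbabilityTheory Polynomial Matrix

/-- The polynomial `∏_{i < d} (X - a i)`. -/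
noncomputable def newtonPoly (a : ℕ → ℝ) (d : ℕ) : Polynomial ℝ :=
  ∏ i ∈ Finset.range d, (Polynomial.X - Polynomial.C (a i))

/-- The polynomial `∏_{d ≤ i < N} (X - a i)`. -/
noncomputable def tailPoly (a : ℕ → ℝ) (N d : ℕ) : Polynomial ℝ :=
  ∏ i ∈ Finset.Ico d N, (Polynomial.X - Polynomial.C (a i))

lemma newtonPoly_succ (a : ℕ → ℝ) (d : ℕ) :
    newtonPoly a (d + 1) = newtonPoly a d * (X - C (a d)) :=
  Finset.prod_range_succ _ _

lemma degree_newtonPoly (a : ℕ → ℝ) (d : ℕ) : (newtonPoly a d).degree = d := by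
  simp [newtonPoly, degree_prod, degree_X_sub_C]

lemma tailPoly_eq_mul (a : ℕ → ℝ) {N d : ℕ} (h : d < N) :
    tailPoly a N d = (X - C (a d)) * tailPoly a N (d + 1) :=
  Finset.prod_eq_prod_Ico_succ_bot h _

lemma newtonPoly_coeff_unique (a : ℕ → ℝ) (N : ℕ) (c e : ℕ → ℝ)
    (h : ∑ d ∈ Finset.range N, C (c d) * newtonPoly a d =
      ∑ d ∈ Finset.range N, C (e d) * newtonPoly a d) : ∀ d < N, c d = e d := by
  let S : Polynomial.Sequence ℝ := ⟨newtonPoly a, degree_newtonPoly a⟩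
  have hS := linearIndependent_iff'.mp S.linearIndependent (Finset.range N) (fun d => c d - e d)
    (by
      change ∑ i ∈ Finset.range N, (c i - e i) • newtonPoly a i = 0
      simp only [sub_smul, Finset.sum_sub_distrib, smul_eq_C_mul, h, sub_self])
  intro d hd
  have := hS d (Finset.mem_range.2 hd)
  linarith

/-- Expansion of the adjugate of the characteristic matrix in the Newton basis of the
eigenvalues. -/
lemma adjugate_charmatrix_apply {n : Type*} [Fintype n] [DecidableEq n] (M : Matrix n n ℝ)
    (a : ℕ → ℝ) (N : ℕ) (hM : M.charpoly = newtonPoly a N) (i j : n) :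
    (charmatrix M).adjugate i j =
      ∑ d ∈ Finset.range N, C (aeval M (tailPoly a N (d + 1)) i j) * newtonPoly a d := by
  set W : ℕ → Matrix n n ℝ := fun d => aeval M (tailPoly a N d) with hW
  set R : Matrix n n ℝ[X] := ∑ d ∈ Finset.range N, newtonPoly a d • (C.mapMatrix (W (d + 1)))
    with hR
  have hWsucc : ∀ d < N, W d = M * W (d + 1) - a d • W (d + 1) := by
    intro d hd
    simp only [hW, tailPoly_eq_mul a hd, map_mul, map_sub, aeval_X, aeval_C, sub_mul]
    rw [Algebra.algebraMap_eq_smul_one, smul_mul_assoc, one_mul]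
  have hstep : ∀ d < N, charmatrix M * (newtonPoly a d • (C.mapMatrix (W (d + 1)))) =
      newtonPoly a (d + 1) • (C.mapMatrix (W (d + 1))) -
        newtonPoly a d • (C.mapMatrix (W d)) := by
    intro d hd
    rw [hWsucc d hd, map_sub, map_mul, charmatrix, sub_mul, newtonPoly_succ]
    ext1 p q
    simp only [mul_smul_comm, Matrix.sub_apply, Matrix.smul_apply, Matrix.scalar_apply,
      Matrix.diagonal_mul, RingHom.mapMatrix_apply, Matrix.map_apply, smul_eq_mul, map_mul]
    ring
  have hmul : charmatrix M * R = M.charpoly • (1 : Matrix n n ℝ[X]) := by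
    rw [hR, Finset.mul_sum, Finset.sum_congr rfl fun d hd => hstep d (Finset.mem_range.1 hd),
      Finset.sum_range_sub (fun d => newtonPoly a d • (C.mapMatrix (W d)))]
    have h0 : W 0 = 0 := by
      have : tailPoly a N 0 = newtonPoly a N := by simp [tailPoly, newtonPoly]
      simp only [hW, this, ← hM, aeval_self_charpoly]
    have hN : W N = 1 := by simp [hW, tailPoly]
    rw [h0, hN, hM]
    simp
  have hadj : M.charpoly • R = M.charpoly • (charmatrix M).adjugate := by
    have := congrArg ((charmatrix M).adjugate * ·) hmul
    simp only [← mul_assoc, adjugate_mul, Algebra.mul_smul_comm, mul_one] at this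
    rw [← this, smul_mul_assoc, one_mul]
    rfl
  have hne : M.charpoly ≠ 0 := (charpoly_monic M).ne_zero
  have : R i j = (charmatrix M).adjugate i j := by
    have := congrFun (congrFun hadj i) j
    simpa [hne] using this
  rw [← this, hR, Matrix.sum_apply]
  refine Finset.sum_congr rfl fun d _ => ?_
  simp [mul_comm, hW]

/-- Nonnegative combinations of Newton polynomials, under domination of the nodes. -/
lemma newtonPoly_expand_nonneg (a b : ℕ → ℝ) (N : ℕ)
    (ha : ∀ i j, i ≤ j → j < N → a j ≤ a i) (hab : ∀ i, i < N → b i ≤ a i) (d : ℕ) (hd : d ≤ N) :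
    ∃ h : ℕ → ℝ, (∀ e, 0 ≤ h e) ∧
      newtonPoly b d = ∑ e ∈ Finset.range (d + 1), C (h e) * newtonPoly a e := by
  induction d with
  | zero => exact ⟨fun _ => 1, fun _ => zero_le_one, by simp [newtonPoly]⟩
  | succ d ih =>
    obtain ⟨h, h0, hh⟩ := ih (by omega)
    refine ⟨fun e => (if e = 0 then 0 else h (e - 1)) +
      (if e ≤ d then (a e - b d) * h e else 0), fun e => ?_, ?_⟩
    · refine add_nonneg (by split_ifs <;> simp [h0]) ?_
      split_ifs with hed
      · exact mul_nonneg (by linarith [ha e d hed (by omega), hab d (by omega)]) (h0 e)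
      · rfl
    · have h1 : ∑ e ∈ Finset.range (d + 2),
          C (if e ≤ d then (a e - b d) * h e else 0) * newtonPoly a e =
          ∑ e ∈ Finset.range (d + 1), C ((a e - b d) * h e) * newtonPoly a e := by
        rw [Finset.sum_range_succ, if_neg (by omega)]
        simp only [map_zero, zero_mul, add_zero]
        refine Finset.sum_congr rfl fun e he => ?_
        rw [if_pos (by simpa [Nat.lt_succ_iff] using he)]
      have h2 : ∑ e ∈ Finset.range (d + 2),
          C (if e = 0 then 0 else h (e - 1)) * newtonPoly a e =
          ∑ e ∈ Finset.range (d + 1), C (h e) * newtonPoly a (e + 1) := by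
        rw [Finset.sum_range_succ']
        simp
      simp only [map_add, add_mul, Finset.sum_add_distrib]
      rw [h1, h2, newtonPoly_succ, hh, ← Finset.sum_add_distrib, Finset.sum_mul]
      refine Finset.sum_congr rfl fun e _ => ?_
      rw [newtonPoly_succ]
      simp only [map_mul, map_sub]
      ring

/-- Diagonalization of a quadratic form. -/
lemma exists_quadForm_eq_sum {n : Type*} [Fintype n] [DecidableEq n] (M : Matrix n n ℝ)
    (hM : M.IsHermitian) : ∃ Q : (n → ℝ) →ₗ[ℝ] (n → ℝ),
      (∀ x, x ⬝ᵥ M *ᵥ x = ∑ l, hM.eigenvalues l * Q x l ^ 2) ∧ ∀ x, x ⬝ᵥ x = ∑ l, Q x l ^ 2 := by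
  set U : Matrix n n ℝ := (hM.eigenvectorUnitary : Matrix n n ℝ) with hU
  have hUU : U * Uᵀ = 1 := by
    have := Unitary.coe_mul_star_self hM.eigenvectorUnitary
    rwa [Unitary.coe_star, star_eq_conjTranspose, conjTranspose_eq_transpose_of_trivial] at this
  have hspec : M = U * diagonal hM.eigenvalues * Uᵀ := by
    have := hM.spectral_theorem
    rw [Unitary.conjStarAlgAut_apply] at this
    rw [star_eq_conjTranspose, conjTranspose_eq_transpose_of_trivial] at this
    exact this
  refine ⟨Uᵀ.mulVecLin, fun x => ?_, fun x => ?_⟩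
  · conv_lhs => rw [hspec]
    rw [← mulVec_mulVec, ← mulVec_mulVec, dotProduct_mulVec, ← mulVec_transpose]
    simp only [dotProduct, mulVec_diagonal, mulVecLin_apply]
    exact Finset.sum_congr rfl fun l _ => by ring
  · have : x ⬝ᵥ x = x ⬝ᵥ (U * Uᵀ) *ᵥ x := by rw [hUU, one_mulVec]
    rw [this, ← mulVec_mulVec, dotProduct_mulVec, ← mulVec_transpose]
    simp only [dotProduct, mulVecLin_apply, sq]

lemma card_eigenvalues_filter {n : Type*} [Fintype n] [DecidableEq n] (M : Matrix n n ℝ)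
    (hM : M.IsHermitian) (a : ℕ → ℝ) (N : ℕ) (h : M.charpoly = newtonPoly a N) (p : ℝ → Prop)
    [DecidablePred p] :
    Fintype.card {l // p (hM.eigenvalues l)} =
      ((Finset.range N).filter fun k => p (a k)).card := by
  have hroots : (Finset.univ.val.map hM.eigenvalues : Multiset ℝ) =
      (Finset.range N).val.map a := by
    have h1 := hM.roots_charpoly_eq_eigenvalues
    rw [h, newtonPoly, Finset.prod_eq_multiset_prod, show (fun i => X - C (a i)) = (fun x => X - C x) ∘ a from rfl,
      ← Multiset.map_map, roots_multiset_prod_X_sub_C] at h1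
    rw [h1]
    rfl
  have := congrArg (Multiset.countP p) hroots
  rw [Multiset.countP_map, Multiset.countP_map] at this
  rw [Fintype.card_subtype]
  exact this

/-- One half of Cauchy interlacing, for a principal submatrix with one index deleted. -/
lemma interlacing {n : ℕ} (M : Matrix (Fin (n + 1)) (Fin (n + 1)) ℝ) (hM : M.IsSymm)
    (j : Fin (n + 1)) (a b : ℕ → ℝ) (ha : ∀ i k, i ≤ k → k < n + 1 → a k ≤ a i)
    (hb : ∀ i k, i ≤ k → k < n → b k ≤ b i) (hMa : M.charpoly = newtonPoly a (n + 1))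
    (hMb : (M.submatrix j.succAbove j.succAbove).charpoly = newtonPoly b n) :
    ∀ i, i < n → b i ≤ a i := by
  intro i hi
  by_contra! hlt
  set B := M.submatrix j.succAbove j.succAbove with hBdef
  have hMH : M.IsHermitian := by
    rw [IsHermitian, conjTranspose_eq_transpose_of_trivial]; exact hM
  have hBH : B.IsHermitian := hMH.submatrix _
  obtain ⟨Q, hQ, hQ1⟩ := exists_quadForm_eq_sum M hMH
  obtain ⟨R, hR, hR1⟩ := exists_quadForm_eq_sum B hBH
  let ext : (Fin n → ℝ) →ₗ[ℝ] (Fin (n + 1) → ℝ) :=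
    { toFun := fun x => j.insertNth (0 : ℝ) x
      map_add' := fun x y => by
        ext k; refine Fin.succAboveCases j ?_ (fun k => ?_) k <;> simp
      map_smul' := fun c x => by
        ext k; refine Fin.succAboveCases j ?_ (fun k => ?_) k <;> simp }
  have hext : ∀ x, ext x = j.insertNth (0 : ℝ) x := fun _ => rfl
  have hquad : ∀ x, ext x ⬝ᵥ M *ᵥ ext x = x ⬝ᵥ B *ᵥ x := by
    intro x
    simp [hext, dotProduct, mulVec, Fin.sum_univ_succAbove _ j, hBdef]
  have hsq : ∀ x, ext x ⬝ᵥ ext x = x ⬝ᵥ x := by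
    intro x
    simp [hext, dotProduct, Fin.sum_univ_succAbove _ j]
  let Φ : (Fin n → ℝ) →ₗ[ℝ] ({l // hBH.eigenvalues l < b i} → ℝ) ×
      ({l // a i < hMH.eigenvalues l} → ℝ) :=
    LinearMap.prod ((LinearMap.funLeft ℝ ℝ Subtype.val) ∘ₗ R)
      ((LinearMap.funLeft ℝ ℝ Subtype.val) ∘ₗ Q ∘ₗ ext)
  have hcard1 : Fintype.card {l // hBH.eigenvalues l < b i} ≤ n - i - 1 := by
    rw [card_eigenvalues_filter B hBH b n hMb (fun x => x < b i)]
    calc _ ≤ (Finset.Ico (i + 1) n).card := Finset.card_le_card fun k hk => by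
            simp only [Finset.mem_filter, Finset.mem_range, Finset.mem_Ico] at hk ⊢
            refine ⟨?_, hk.1⟩
            by_contra! hki
            exact absurd (hb k i (by omega) hi) (not_le.2 hk.2)
      _ = _ := by simp; omega
  have hcard2 : Fintype.card {l // a i < hMH.eigenvalues l} ≤ i := by
    rw [card_eigenvalues_filter M hMH a (n + 1) hMa (fun x => a i < x)]
    calc _ ≤ (Finset.range i).card := Finset.card_le_card fun k hk => by
            simp only [Finset.mem_filter, Finset.mem_range] at hk ⊢
            by_contra! hki
            exact absurd (ha i k hki hk.1) (not_le.2 hk.2)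
      _ = _ := by simp
  have hker : LinearMap.ker Φ ≠ ⊥ := by
    apply LinearMap.ker_ne_bot_of_finrank_lt
    simp only [Module.finrank_prod, Module.finrank_fintype_fun_eq_card, Fintype.card_fin]
    omega
  obtain ⟨x, hx, hx0⟩ := Submodule.exists_mem_ne_zero_of_ne_bot hker
  have hx1 : ∀ l, hBH.eigenvalues l < b i → R x l = 0 := fun l hl =>
    congrFun (congrArg Prod.fst (LinearMap.mem_ker.1 hx)) ⟨l, hl⟩
  have hx2 : ∀ l, a i < hMH.eigenvalues l → Q (ext x) l = 0 := fun l hl =>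
    congrFun (congrArg Prod.snd (LinearMap.mem_ker.1 hx)) ⟨l, hl⟩
  have h1 : b i * (x ⬝ᵥ x) ≤ x ⬝ᵥ B *ᵥ x := by
    rw [hR, hR1, Finset.mul_sum]
    refine Finset.sum_le_sum fun l _ => ?_
    rcases lt_or_ge (hBH.eigenvalues l) (b i) with hl | hl
    · simp [hx1 l hl]
    · exact mul_le_mul_of_nonneg_right hl (sq_nonneg _)
  have h2 : ext x ⬝ᵥ M *ᵥ ext x ≤ a i * (ext x ⬝ᵥ ext x) := by
    rw [hQ, hQ1, Finset.mul_sum]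
    refine Finset.sum_le_sum fun l _ => ?_
    rcases lt_or_ge (a i) (hMH.eigenvalues l) with hl | hl
    · simp [hx2 l hl]
    · exact mul_le_mul_of_nonneg_right hl (sq_nonneg _)
  rw [hquad, hsq] at h2
  have h3 : 0 < x ⬝ᵥ x := by
    refine lt_of_le_of_ne (Finset.sum_nonneg fun l _ => mul_self_nonneg _) ?_
    intro h
    exact hx0 (dotProduct_self_eq_zero.1 h.symm)
  nlinarith

/-- A symmetric matrix has a nonincreasing list of real eigenvalues. -/
lemma exists_antitone_charpoly_eq {n : ℕ} (M : Matrix (Fin n) (Fin n) ℝ) (hM : M.IsSymm) :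
    ∃ a : ℕ → ℝ, (∀ i k, i ≤ k → k < n → a k ≤ a i) ∧ M.charpoly = newtonPoly a n := by
  have hMH : M.IsHermitian := by
    rw [IsHermitian, conjTranspose_eq_transpose_of_trivial]; exact hM
  refine ⟨fun k => if h : k < n then hMH.eigenvalues₀ ⟨k, by simpa using h⟩ else 0,
    fun i k hik hk => ?_, ?_⟩
  · simp only [hk, lt_of_le_of_lt hik hk, dif_pos]
    exact hMH.eigenvalues₀_antitone hik
  · rw [hMH.charpoly_eq, newtonPoly, ← Fin.prod_univ_eq_prod_range
      (fun k => X - C (if h : k < n then hMH.eigenvalues₀ ⟨k, by simpa using h⟩ else 0)) n]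
    simp only [IsHermitian.eigenvalues, Fin.is_lt, dif_pos]
    refine (Equiv.prod_comp (Fintype.equivOfCardEq (Fintype.card_fin _)).symm
      (fun k => X - C ((hMH.eigenvalues₀ k : ℝ)))).trans ?_
    exact (Equiv.prod_comp (finCongr (Fintype.card_fin n).symm)
      (fun k => X - C ((hMH.eigenvalues₀ k : ℝ)))).symm

/-- **Micchelli–Willoughby**: for a symmetric nonnegative matrix `M` with eigenvalues
`a 0 ≥ ⋯ ≥ a (N - 1)`, the products `∏_{d ≤ i < N} (M - a i)` are nonnegative entrywise. -/
theorem aeval_tailPoly_nonneg (N : ℕ) : ∀ (M : Matrix (Fin N) (Fin N) ℝ), M.IsSymm →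
    (∀ i j, 0 ≤ M i j) → ∀ a : ℕ → ℝ, (∀ i k, i ≤ k → k < N → a k ≤ a i) →
    M.charpoly = newtonPoly a N → ∀ d i j, 0 ≤ aeval M (tailPoly a N d) i j := by
  induction N with
  | zero => exact fun _ _ _ _ _ _ _ i => i.elim0
  | succ n ih =>
    intro M hM h0 a ha hMa d i j
    set B := M.submatrix j.succAbove j.succAbove with hBdef
    have hB : B.IsSymm := hM.submatrix _
    obtain ⟨b, hb, hBb⟩ := exists_antitone_charpoly_eq B hB
    have hab := interlacing M hM j a b ha hb hMa hBb
    have hWB := ih B hB (fun _ _ => h0 _ _) b hb hBb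
    have hjj : (charmatrix M).adjugate j j = B.charpoly := by
      rw [adjugate_fin_succ_eq_det_submatrix]
      have : (charmatrix M).submatrix j.succAbove j.succAbove = charmatrix B := by
        ext1 p q
        simp [charmatrix_apply, hBdef, diagonal_apply]
      rw [this, ← two_mul, pow_mul]
      simp [Matrix.charpoly]
    have hBne : B.charpoly ≠ 0 := (charpoly_monic B).ne_zero
    have hcol : (fun k => (charmatrix M).adjugate (j.succAbove k) j) =
        (charmatrix B).adjugate *ᵥ (fun l => C (M (j.succAbove l) j)) := by
      have h1 : charmatrix B *ᵥ (fun k => (charmatrix M).adjugate (j.succAbove k) j) =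
          B.charpoly • (fun l => C (M (j.succAbove l) j)) := by
        ext1 l
        have := congrFun (congrFun (mul_adjugate (charmatrix M)) (j.succAbove l)) j
        rw [Matrix.mul_apply, Fin.sum_univ_succAbove _ j, hjj,
          charmatrix_apply_ne _ _ _ (Fin.succAbove_ne j l)] at this
        simp only [Matrix.smul_apply, one_apply_ne (Fin.succAbove_ne j l), smul_zero] at this
        have h2 : ∀ k, charmatrix M (j.succAbove l) (j.succAbove k) = charmatrix B l k := by
          intro k
          simp [charmatrix_apply, hBdef, diagonal_apply]
        simp only [h2] at this
        simp only [mulVec, dotProduct, Pi.smul_apply, smul_eq_mul]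
        linear_combination this
      have h3 := congrArg ((charmatrix B).adjugate *ᵥ ·) h1
      simp only [mulVec_mulVec, adjugate_mul, mulVec_smul, smul_mulVec, one_mulVec] at h3
      exact smul_right_injective _ hBne h3
    have key : ∃ h : ℕ → ℝ, (∀ e, 0 ≤ h e) ∧ (charmatrix M).adjugate i j =
        ∑ e ∈ Finset.range (n + 1), C (h e) * newtonPoly a e := by
      rcases Fin.eq_self_or_eq_succAbove j i with rfl | ⟨k, rfl⟩
      · rw [hjj, hBb]
        exact newtonPoly_expand_nonneg a b n (fun i k hik hk => ha i k hik (by omega)) hab n le_rfl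
      · choose! h hh0 hh using newtonPoly_expand_nonneg a b n
          (fun i k hik hk => ha i k hik (by omega)) hab
        have h4 : ∀ e ∈ Finset.range n, newtonPoly b e =
            ∑ f ∈ Finset.range (n + 1), C (if f ≤ e then h e f else 0) * newtonPoly a f := by
          intro e he
          rw [Finset.mem_range] at he
          rw [hh e he.le, ← Finset.sum_subset (Finset.range_mono (by omega : e + 1 ≤ n + 1))]
          · refine Finset.sum_congr rfl fun f hf => ?_
            rw [if_pos (by simpa [Nat.lt_succ_iff] using hf)]
          · intro f _ hf
            rw [if_neg (by simpa using hf)]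
            simp
        refine ⟨fun f => ∑ l, ∑ e ∈ Finset.range n,
          aeval B (tailPoly b n (e + 1)) k l * (if f ≤ e then h e f else 0) * M (j.succAbove l) j,
          fun f => ?_, ?_⟩
        · refine Finset.sum_nonneg fun l _ => Finset.sum_nonneg fun e he => ?_
          refine mul_nonneg (mul_nonneg (hWB _ _ _) ?_) (h0 _ _)
          split_ifs
          · exact hh0 e (Finset.mem_range.1 he).le f
          · rfl
        · have := congrFun hcol k
          refine this.trans ?_
          simp only [mulVec, dotProduct, adjugate_charmatrix_apply B b n hBb, map_sum,
            Finset.sum_mul, map_mul]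
          conv_rhs => rw [Finset.sum_comm]
          refine Finset.sum_congr rfl fun l _ => ?_
          conv_rhs => rw [Finset.sum_comm]
          refine Finset.sum_congr rfl fun e he => ?_
          rw [h4 e he, Finset.mul_sum, Finset.sum_mul]
          exact Finset.sum_congr rfl fun f _ => by ring
    obtain ⟨h, hh0, hh⟩ := key
    rw [adjugate_charmatrix_apply M a (n + 1) hMa] at hh
    have huniq := newtonPoly_coeff_unique a (n + 1) _ _ hh
    rcases d with _ | d
    · have : tailPoly a (n + 1) 0 = newtonPoly a (n + 1) := by simp [tailPoly, newtonPoly]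
      rw [this, ← hMa, aeval_self_charpoly]
      simp
    · rcases lt_or_ge d (n + 1) with hd | hd
      · rw [huniq d hd]; exact hh0 d
      · have : tailPoly a (n + 1) (d + 1) = 1 := by
          rw [tailPoly, Finset.Ico_eq_empty (by omega), Finset.prod_empty]
        rw [this, map_one, one_apply]
        split_ifs <;> simp

lemma exists_antitone_charpoly_eq_newtonPoly {S : Type*} [Fintype S] [DecidableEq S]
    (M : Matrix S S ℝ) (hM : M.IsSymm) (h0 : ∀ x y, 0 ≤ M x y) :
    ∃ a : ℕ → ℝ, (∀ i k, i ≤ k → k < Fintype.card S → a k ≤ a i) ∧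
      M.charpoly = newtonPoly a (Fintype.card S) ∧
      ∀ d x y, 0 ≤ aeval M (tailPoly a (Fintype.card S) d) x y := by
  let e := Fintype.equivFin S
  have hsymm : (reindexAlgEquiv ℝ ℝ e M).IsSymm := hM.submatrix _
  obtain ⟨a, ha, hMa⟩ := exists_antitone_charpoly_eq (reindexAlgEquiv ℝ ℝ e M) hsymm
  refine ⟨a, ha, ?_, fun d x y => ?_⟩
  · rw [← hMa]
    exact (charpoly_reindex e M).symm
  · have := aeval_tailPoly_nonneg _ (reindexAlgEquiv ℝ ℝ e M) hsymm (fun _ _ => h0 _ _) a ha hMa d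
      (e x) (e y)
    rw [aeval_algHom_apply (reindexAlgEquiv ℝ ℝ e)] at this
    simpa using this

/-- Polynomials in intertwined matrices are intertwined. -/
lemma aeval_mul_eq_mul_aeval {S : Type*} [Fintype S] [DecidableEq S]
    {M P D : Matrix S S ℝ} (h : M * D = D * P) (f : ℝ[X]) :
    aeval M f * D = D * aeval P f := by
  induction f using Polynomial.induction_on' with
  | add p q hp hq => simp only [map_add, add_mul, mul_add, hp, hq]
  | monomial k c =>
    have : M ^ k * D = D * P ^ k := by
      induction k with
      | zero => simp
      | succ k ih => rw [pow_succ, mul_assoc, h, ← mul_assoc, ih, mul_assoc, ← pow_succ]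
    simp only [aeval_monomial, Algebra.algebraMap_eq_smul_one, smul_mul_assoc, one_mul, this,
      mul_smul_comm]

lemma reversibleClass_aeval_tailPoly_nonneg {S : Type*} [Fintype S] [DecidableEq S]
    {P : Matrix S S ℝ} (hP : P ∈ MarkovSep.reversibleClass S) :
    ∃ a : ℕ → ℝ, (∀ i k, i ≤ k → k < Fintype.card S → a k ≤ a i) ∧
      P.charpoly = newtonPoly a (Fintype.card S) ∧
      ∀ d x y, 0 ≤ aeval P (tailPoly a (Fintype.card S) d) x y := by
  obtain ⟨hst, π, -, hpos, hrev⟩ := hP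
  set s : S → ℝ := fun x => √(π x) with hs
  have hs0 : ∀ x, 0 < s x := fun x => Real.sqrt_pos.2 (hpos x)
  have hss : ∀ x, s x * s x = π x := fun x => Real.mul_self_sqrt (hpos x).le
  set D : Matrix S S ℝ := diagonal s with hD
  set E : Matrix S S ℝ := diagonal fun x => (s x)⁻¹ with hE
  have hDE : D * E = 1 := by
    rw [hD, hE, diagonal_mul_diagonal, ← diagonal_one]
    congr 1; ext x; exact mul_inv_cancel₀ (hs0 x).ne'
  have hED : E * D = 1 := by
    rw [hD, hE, diagonal_mul_diagonal, ← diagonal_one]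
    congr 1; ext x; exact inv_mul_cancel₀ (hs0 x).ne'
  set M := D * P * E with hM
  have hMapp : ∀ x y, M x y = s x * P x y * (s y)⁻¹ := by
    intro x y
    rw [hM, hD, hE, mul_diagonal, diagonal_mul]
  have hMsymm : M.IsSymm := by
    ext x y
    rw [transpose_apply, hMapp, hMapp]
    have h1 := hrev x y
    rw [← hss, ← hss] at h1
    have := (hs0 x).ne'
    have := (hs0 y).ne'
    field_simp
    linarith
  have hM0 : ∀ x y, 0 ≤ M x y := fun x y => by
    rw [hMapp]
    exact mul_nonneg (mul_nonneg (hs0 x).le (hst.1 x y)) (inv_nonneg.2 (hs0 y).le)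
  obtain ⟨a, ha, hMa, hW⟩ := exists_antitone_charpoly_eq_newtonPoly M hMsymm hM0
  refine ⟨a, ha, ?_, fun d x y => ?_⟩
  · rw [← hMa, hM, charpoly_mul_comm, ← mul_assoc, hED, one_mul]
  · have h2 : M * D = D * P := by rw [hM, mul_assoc, hED, mul_one]
    have h3 := congrFun (congrFun
      (aeval_mul_eq_mul_aeval h2 (tailPoly a (Fintype.card S) d)) x) y
    rw [hD, mul_diagonal, diagonal_mul] at h3
    refine nonneg_of_mul_nonneg_right ?_ (hs0 x)
    rw [← h3]
    exact mul_nonneg (hW d x y) (hs0 y).le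

lemma abs_le_one_of_isRoot_charpoly {S : Type*} [Fintype S] [DecidableEq S]
    {P : Matrix S S ℝ} (hP : P ∈ Matrix.rowStochastic ℝ S) {r : ℝ} (hr : P.charpoly.IsRoot r) :
    r ∈ Set.Icc (-1 : ℝ) 1 := by
  have hev : Module.End.HasEigenvalue (toLin' P) r := by
    rw [Module.End.hasEigenvalue_iff_isRoot_charpoly, charpoly_toLin']
    exact hr
  obtain ⟨k, hk⟩ := eigenvalue_mem_ball hev
  have hsum : ∑ j ∈ Finset.univ.erase k, ‖P k j‖ = 1 - P k k := by
    rw [← sum_row_of_mem_rowStochastic hP k, ← Finset.add_sum_erase _ _ (Finset.mem_univ k),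
      add_sub_cancel_left]
    exact Finset.sum_congr rfl fun j _ => Real.norm_of_nonneg (hP.1 k j)
  rw [hsum, Metric.mem_closedBall, Real.dist_eq, abs_le] at hk
  have := hP.1 k k
  constructor <;> linarith [hk.1, hk.2]

lemma continuous_aeval_prod_X_sub_C {S : Type*} [Fintype S] [DecidableEq S] (s : Finset ℕ) :
    Continuous fun p : (ℕ → Set.Icc (-1 : ℝ) 1) × Matrix S S ℝ =>
      aeval p.2 (∏ i ∈ s, (X - C (p.1 i : ℝ))) := by
  induction s using Finset.induction_on with
  | empty => simpa using continuous_const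
  | insert i s hi ih =>
    simp only [Finset.prod_insert hi, map_mul, map_sub, aeval_X, aeval_C]
    refine Continuous.mul (continuous_snd.sub ?_) ih
    simp only [Algebra.algebraMap_eq_smul_one]
    have hc : Continuous fun p : (ℕ → Set.Icc (-1 : ℝ) 1) × Matrix S S ℝ => (p.1 i : ℝ) :=
      continuous_subtype_val.comp ((continuous_apply i).comp continuous_fst)
    exact hc.smul continuous_const

lemma closure_reversibleClass_aeval_tailPoly_nonneg {S : Type*} [Fintype S] [DecidableEq S]
    {P : Matrix S S ℝ} (hP : P ∈ closure (MarkovSep.reversibleClass S)) :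
    ∃ a : ℕ → ℝ, (∀ i k, i ≤ k → k < Fintype.card S → a k ≤ a i) ∧
      P.charpoly = newtonPoly a (Fintype.card S) ∧
      ∀ d x y, 0 ≤ aeval P (tailPoly a (Fintype.card S) d) x y := by
  set N := Fintype.card S with hN
  let K : Set ((ℕ → Set.Icc (-1 : ℝ) 1) × Matrix S S ℝ) :=
    {p | (∀ i k, i ≤ k → k < N → (p.1 k : ℝ) ≤ p.1 i) ∧
      (∀ z : ℝ, (scalar S z - p.2).det = ∏ i ∈ Finset.range N, (z - p.1 i)) ∧
      ∀ d x y, 0 ≤ aeval p.2 (∏ i ∈ Finset.Ico d N, (X - C (p.1 i : ℝ))) x y}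
  have hcoord : ∀ i, Continuous fun p : (ℕ → Set.Icc (-1 : ℝ) 1) × Matrix S S ℝ =>
      (p.1 i : ℝ) := fun i =>
    continuous_subtype_val.comp ((continuous_apply i).comp continuous_fst)
  have hK : IsClosed K := by
    have hA : IsClosed {p : (ℕ → Set.Icc (-1 : ℝ) 1) × Matrix S S ℝ |
        ∀ i k, i ≤ k → k < N → (p.1 k : ℝ) ≤ p.1 i} := by
      simp only [Set.ofPred_forall]
      exact isClosed_iInter fun i => isClosed_iInter fun k => isClosed_iInter fun _ =>
        isClosed_iInter fun _ => isClosed_le (hcoord k) (hcoord i)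
    have hB : IsClosed {p : (ℕ → Set.Icc (-1 : ℝ) 1) × Matrix S S ℝ |
        ∀ z : ℝ, (scalar S z - p.2).det = ∏ i ∈ Finset.range N, (z - p.1 i)} := by
      simp only [Set.ofPred_forall]
      refine isClosed_iInter fun z => isClosed_eq ?_ ?_
      · exact Continuous.matrix_det (continuous_const.sub continuous_snd)
      · exact continuous_finsetProd _ fun i _ => continuous_const.sub (hcoord i)
    have hC : IsClosed {p : (ℕ → Set.Icc (-1 : ℝ) 1) × Matrix S S ℝ |
        ∀ d x y, 0 ≤ aeval p.2 (∏ i ∈ Finset.Ico d N, (X - C (p.1 i : ℝ))) x y} := by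
      simp only [Set.ofPred_forall]
      refine isClosed_iInter fun d => isClosed_iInter fun x => isClosed_iInter fun y =>
        isClosed_le continuous_const ?_
      exact (continuous_aeval_prod_X_sub_C (Finset.Ico d N)).matrix_elem x y
    exact hA.inter (hB.inter hC)
  have hsub : MarkovSep.reversibleClass S ⊆ Prod.snd '' K := by
    intro Q hQ
    obtain ⟨a, ha, hQa, hW⟩ := reversibleClass_aeval_tailPoly_nonneg hQ
    have hmem : ∀ i, i < N → a i ∈ Set.Icc (-1 : ℝ) 1 := by
      intro i hi
      refine abs_le_one_of_isRoot_charpoly hQ.1 ?_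
      rw [hQa, IsRoot, newtonPoly, eval_prod]
      exact Finset.prod_eq_zero (Finset.mem_range.2 hi) (by simp)
    let a' : ℕ → Set.Icc (-1 : ℝ) 1 := fun i => Set.projIcc (-1) 1 (by norm_num) (a i)
    have ha' : ∀ i, i < N → (a' i : ℝ) = a i := fun i hi => by
      simp only [a', Set.projIcc_of_mem _ (hmem i hi)]
    refine ⟨(a', Q), ⟨fun i k hik hk => ?_, fun z => ?_, fun d x y => ?_⟩, rfl⟩
    · simp only [ha' k hk, ha' i (by omega)]
      exact ha i k hik hk
    · rw [← eval_charpoly, hQa, newtonPoly, eval_prod]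
      refine Finset.prod_congr rfl fun i hi => ?_
      simp [ha' i (Finset.mem_range.1 hi)]
    · convert hW d x y using 5
      refine Finset.prod_congr rfl fun i hi => ?_
      rw [ha' i (Finset.mem_Ico.1 hi).2]
  obtain ⟨⟨a, Q⟩, ⟨h1, h2, h3⟩, rfl⟩ :=
    closure_minimal hsub (isClosedMap_snd_of_compactSpace K hK) hP
  refine ⟨fun i => a i, h1, ?_, h3⟩
  refine Polynomial.funext fun z => ?_
  rw [eval_charpoly, newtonPoly, eval_prod]
  simpa using h2 z

lemma eq_reflect_of_newtonPoly_eq {N : ℕ} {a b : ℕ → ℝ}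
    (ha : ∀ i k, i ≤ k → k < N → a k ≤ a i) (hb : ∀ i k, i ≤ k → k < N → b i ≤ b k)
    (h : newtonPoly a N = newtonPoly b N) : ∀ i, i < N → a i = b (N - 1 - i) := by
  have hperm : ((List.range N).map a).Perm (((List.range N).map b).reverse) := by
    refine List.Perm.trans ?_ (List.reverse_perm _).symm
    rw [← Multiset.coe_eq_coe]
    have h1 := congrArg roots h
    simp only [newtonPoly, Finset.prod_eq_multiset_prod] at h1
    rw [show (fun i => X - C (a i)) = (fun x => X - C x) ∘ a from rfl,
      show (fun i => X - C (b i)) = (fun x => X - C x) ∘ b from rfl,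
      ← Multiset.map_map, ← Multiset.map_map, roots_multiset_prod_X_sub_C,
      roots_multiset_prod_X_sub_C] at h1
    exact h1
  have hEq := hperm.eq_of_pairwise' (r := (· ≥ ·))
    (by
      rw [List.pairwise_map]
      refine List.pairwise_lt_range.imp_of_mem fun {i k} _ hk hik => ?_
      exact ha i k hik.le (List.mem_range.1 hk))
    (by
      rw [List.pairwise_reverse, List.pairwise_map]
      refine List.pairwise_lt_range.imp_of_mem fun {i k} _ hk hik => ?_
      exact hb i k hik.le (List.mem_range.1 hk))
  intro i hi
  have := congrArg (fun l : List ℝ => l[i]?) hEq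
  simpa [List.getElem?_reverse, hi, show N - 1 - i < N by omega] using this

/-- Products of the lowest spectral factors of a matrix in the closure of the reversible
class are nonnegative. -/
theorem aeval_newtonPoly_nonneg {S : Type*} [Fintype S] [DecidableEq S]
    {P : Matrix S S ℝ} (hP : P ∈ closure (MarkovSep.reversibleClass S)) {b : ℕ → ℝ}
    (hb : ∀ i k, i ≤ k → k < Fintype.card S → b i ≤ b k)
    (hPb : P.charpoly = newtonPoly b (Fintype.card S)) (m : ℕ) (hm : m ≤ Fintype.card S) (x y : S) :
    0 ≤ aeval P (newtonPoly b m) x y := by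
  obtain ⟨a, ha, hPa, hW⟩ := closure_reversibleClass_aeval_tailPoly_nonneg hP
  have hab := eq_reflect_of_newtonPoly_eq ha hb (hPa.symm.trans hPb)
  have hN : 0 < Fintype.card S := Fintype.card_pos_iff.2 ⟨x⟩
  generalize Fintype.card S = N at *
  convert hW (N - m) x y using 4
  have h1 : tailPoly a N (N - m) = ∏ i ∈ Finset.Ico (N - m) N, (X - C (b (N - 1 - i))) :=
    Finset.prod_congr rfl fun i hi => by rw [hab i (Finset.mem_Ico.1 hi).2]
  rw [h1, newtonPoly, Finset.prod_Ico_reflect (fun i => X - C (b i)) _ (by omega : N ≤ N - 1 + 1),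
    Finset.range_eq_Ico]
  congr 2 <;> omega

lemma MarkovSep.IsReversible.vecMul_eq {S : Type*} [Fintype S] [DecidableEq S]
    {P : Matrix S S ℝ} {π : S → ℝ} (h : MarkovSep.IsReversible P π)
    (hP : P ∈ Matrix.rowStochastic ℝ S) : π ᵥ* P = π := by
  ext y
  simp only [vecMul, dotProduct]
  rw [Finset.sum_congr rfl fun x _ => h x y, ← Finset.mul_sum, sum_row_of_mem_rowStochastic hP,
    mul_one]

lemma vecMul_aeval_newtonPoly {S : Type*} [Fintype S] [DecidableEq S] {P : Matrix S S ℝ}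
    {π : S → ℝ} (h : π ᵥ* P = π) (b : ℕ → ℝ) (k : ℕ) :
    π ᵥ* aeval P (newtonPoly b k) = (∏ j ∈ Finset.range k, (1 - b j)) • π := by
  induction k with
  | zero => simp [newtonPoly]
  | succ k ih =>
    rw [newtonPoly_succ, map_mul, ← vecMul_vecMul, ih, smul_vecMul, Finset.prod_range_succ,
      mul_smul]
    congr 1
    simp [vecMul_sub, h, Algebra.algebraMap_eq_smul_one, vecMul_smul, sub_smul]

/-- If `1` is a simple eigenvalue of a stochastic matrix, harmonic functions are constant. -/
lemma const_of_mulVec_eq {S : Type*} [Fintype S] [DecidableEq S] {P : Matrix S S ℝ}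
    (hP : P ∈ Matrix.rowStochastic ℝ S) {q : ℝ[X]} (hq : q.eval 1 ≠ 0)
    (hPq : P.charpoly = q * (X - C 1)) {v : S → ℝ} (hv : P *ᵥ v = v) (x y : S) : v x = v y := by
  have hmult : P.charpoly.rootMultiplicity 1 = 1 := by
    rw [hPq, rootMultiplicity_mul (by rw [← hPq]; exact (charpoly_monic P).ne_zero),
      rootMultiplicity_X_sub_C_self, rootMultiplicity_eq_zero hq]
  have hrank : Module.finrank ℝ (Module.End.eigenspace (toLin' P) 1) ≤ 1 := by
    have := LinearMap.finrank_eigenspace_le (toLin' P) 1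
    rwa [charpoly_toLin', hmult] at this
  have hmem : ∀ w : S → ℝ, P *ᵥ w = w → w ∈ Module.End.eigenspace (toLin' P) 1 := fun w hw => by
    rw [Module.End.mem_eigenspace_iff, toLin'_apply, hw, one_smul]
  obtain ⟨w, hw⟩ := finrank_le_one_iff.1 hrank
  obtain ⟨c, hc⟩ := hw ⟨v, hmem v hv⟩
  obtain ⟨c', hc'⟩ := hw ⟨1, hmem 1 (one_vecMul_of_mem_rowStochastic hP)⟩
  have h1 : ∀ z, c * (w : S → ℝ) z = v z := fun z => congrFun (congrArg Subtype.val hc) z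
  have h2 : ∀ z, c' * (w : S → ℝ) z = 1 := fun z => congrFun (congrArg Subtype.val hc') z
  have hc0 : c' ≠ 0 := by
    rintro rfl
    simpa using h2 x
  rw [← h1, ← h1, mul_left_cancel₀ hc0 ((h2 x).trans (h2 y).symm)]

/-- The link distributions `μ ∏_{j < k} (P - b j) / (1 - b j)`. -/
noncomputable def linkDist {S : Type*} [Fintype S] [DecidableEq S] (P : Matrix S S ℝ)
    (b : ℕ → ℝ) (μ : S → ℝ) (k : ℕ) : S → ℝ :=
  (∏ j ∈ Finset.range k, (1 - b j))⁻¹ • (μ ᵥ* aeval P (newtonPoly b k))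

lemma linkDist_zero {S : Type*} [Fintype S] [DecidableEq S] (P : Matrix S S ℝ)
    (b : ℕ → ℝ) (μ : S → ℝ) : linkDist P b μ 0 = μ := by
  simp [linkDist, newtonPoly]

lemma linkDist_vecMul {S : Type*} [Fintype S] [DecidableEq S] (P : Matrix S S ℝ)
    (b : ℕ → ℝ) (μ : S → ℝ) (k : ℕ) (hk : b k ≠ 1) :
    linkDist P b μ k ᵥ* P = b k • linkDist P b μ k + (1 - b k) • linkDist P b μ (k + 1) := by
  have h1 : (1 - b k) ≠ 0 := sub_ne_zero.2 (Ne.symm hk)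
  simp only [linkDist, Finset.prod_range_succ, newtonPoly_succ, map_mul, map_sub, aeval_X,
    aeval_C, Algebra.algebraMap_eq_smul_one, mul_sub, mul_smul_comm, mul_one, smul_vecMul,
    vecMul_vecMul, vecMul_sub, vecMul_smul]
  ext x
  simp only [Pi.add_apply, Pi.smul_apply, Pi.sub_apply, smul_eq_mul]
  field_simp
  ring

lemma linkDist_nonneg {S : Type*} [Fintype S] [DecidableEq S] {P : Matrix S S ℝ}
    {b : ℕ → ℝ} {μ : S → ℝ} {k : ℕ} (hμ : ∀ x, 0 ≤ μ x) (hb : ∀ j < k, b j < 1)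
    (hPb : ∀ x y, 0 ≤ aeval P (newtonPoly b k) x y) (x : S) : 0 ≤ linkDist P b μ k x := by
  refine mul_nonneg (inv_nonneg.2 (Finset.prod_nonneg fun j hj => ?_))
    (Finset.sum_nonneg fun y _ => mul_nonneg (hμ y) (hPb y x))
  linarith [hb j (Finset.mem_range.1 hj)]

lemma linkDist_eq_stationary {S : Type*} [Fintype S] [DecidableEq S] {P : Matrix S S ℝ}
    (hP : P ∈ Matrix.rowStochastic ℝ S) {b : ℕ → ℝ} {μ π : S → ℝ} {n : ℕ}
    (hμ : ∑ x, μ x = 1) (hπ : ∑ x, π x = 1) (hπP : π ᵥ* P = π)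
    (hb : ∀ j < n, b j < 1) (hPb : P.charpoly = newtonPoly b n * (X - C 1)) :
    linkDist P b μ n = π := by
  have hc : ∏ j ∈ Finset.range n, (1 - b j) ≠ 0 :=
    Finset.prod_ne_zero_iff.2 fun j hj => by linarith [hb j (Finset.mem_range.1 hj)]
  have hq : (newtonPoly b n).eval 1 ≠ 0 := by
    simpa [newtonPoly, eval_prod] using hc
  set A := aeval P (newtonPoly b n) with hA
  have hPA : P * A = A := by
    have h0 := aeval_self_charpoly P
    rw [hPb, mul_comm, map_mul] at h0
    simp only [map_sub, aeval_X, map_one, sub_mul, one_mul] at h0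
    exact sub_eq_zero.1 h0
  have hconst : ∀ x x' y, A x y = A x' y := by
    intro x x' y
    refine const_of_mulVec_eq hP hq hPb (v := fun z => A z y) ?_ x x'
    ext z
    exact congrFun (congrFun hPA z) y
  have hval : ∀ (p : S → ℝ), ∑ x, p x = 1 → ∀ x y, (p ᵥ* A) y = A x y := by
    intro p hp x y
    simp only [vecMul, dotProduct]
    rw [Finset.sum_congr rfl fun z _ => by rw [hconst z x y], ← Finset.sum_mul, hp, one_mul]
  have hμA : μ ᵥ* A = π ᵥ* A := by
    ext y
    rw [hval μ hμ y y, hval π hπ y y]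
  rw [linkDist, ← hA, hμA, hA, vecMul_aeval_newtonPoly hπP, smul_smul, inv_mul_cancel₀ hc, one_smul]

lemma le_linkDist_vecMul_pow {S : Type*} [Fintype S] [DecidableEq S] {P : Matrix S S ℝ}
    {b : ℕ → ℝ} {μ π : S → ℝ} {n : ℕ} (hπP : π ᵥ* P = π)
    (hb0 : ∀ j < n, 0 ≤ b j) (hb : ∀ j < n, b j < 1)
    (hν : ∀ k ≤ n, ∀ x, 0 ≤ linkDist P b μ k x) (hn : linkDist P b μ n = π)
    (G : ℕ → ℕ → ℝ) (hGn : ∀ t, G n t = 1) (hG0 : ∀ k < n, G k 0 = 0)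
    (hG : ∀ k < n, ∀ t, G k (t + 1) = b k * G k t + (1 - b k) * G (k + 1) t) (t : ℕ) :
    ∀ k ≤ n, ∀ x, G k t * π x ≤ (linkDist P b μ k ᵥ* P ^ t) x := by
  have hπt : ∀ t, π ᵥ* P ^ t = π := by
    intro t
    induction t with
    | zero => simp
    | succ t ih => rw [pow_succ, ← vecMul_vecMul, ih, hπP]
  have htop : ∀ t x, G n t * π x ≤ (linkDist P b μ n ᵥ* P ^ t) x := fun t x => by
    rw [hGn, one_mul, hn, hπt]
  induction t with
  | zero =>
    intro k hk x
    rcases hk.eq_or_lt with rfl | hk'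
    · exact htop 0 x
    · simpa [hG0 k hk'] using hν k hk x
  | succ t ih =>
    intro k hk x
    rcases hk.eq_or_lt with rfl | hk'
    · exact htop _ x
    · rw [pow_succ', ← vecMul_vecMul, linkDist_vecMul P b μ k (hb k hk').ne, add_vecMul,
        smul_vecMul, smul_vecMul, hG k hk', add_mul, mul_assoc, mul_assoc]
      exact add_le_add (mul_le_mul_of_nonneg_left (ih k hk x) (hb0 k hk'))
        (mul_le_mul_of_nonneg_left (ih (k + 1) hk' x) (by linarith [hb k hk']))

section Law
variable {Ω : Type*} [MeasurableSpace Ω] (ρ : Measure Ω)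

lemma measureReal_add_le_eq_sum [IsProbabilityMeasure ρ] {X Y : Ω → ℕ} (hX : Measurable X)
    (hY : Measurable Y) (hXY : IndepFun X Y ρ) (t : ℕ) :
    ρ.real {ω | X ω + Y ω ≤ t} =
      ∑ s ∈ Finset.range (t + 1), ρ.real {ω | X ω = s} * ρ.real {ω | Y ω ≤ t - s} := by
  have hset : {ω | X ω + Y ω ≤ t} =
      ⋃ s ∈ Finset.range (t + 1), (X ⁻¹' {s} ∩ Y ⁻¹' Set.Iic (t - s)) := by
    ext ω
    simp only [Set.mem_ofPred_eq, Set.mem_iUnion, Finset.mem_range, Set.mem_inter_iff,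
      Set.mem_preimage, Set.mem_singleton_iff, Set.mem_Iic, exists_prop]
    constructor
    · intro h
      exact ⟨X ω, by omega, rfl, by omega⟩
    · rintro ⟨s, hs, rfl, h⟩
      omega
  rw [hset, measureReal_biUnion_finset]
  · refine Finset.sum_congr rfl fun s _ => ?_
    rw [measureReal_def, hXY.measure_inter_preimage_eq_mul _ _ (measurableSet_singleton s)
      measurableSet_Iic, ENNReal.toReal_mul]
    rfl
  · intro s _ s' _ hss
    refine Set.disjoint_left.2 fun ω h h' => hss ?_
    exact h.1.symm.trans h'.1
  · intro s _
    exact (hX (measurableSet_singleton s)).inter (hY measurableSet_Iic)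

lemma measureReal_le_eq_sum [IsFiniteMeasure ρ] {X : Ω → ℕ} (hX : Measurable X) (t : ℕ) :
    ρ.real {ω | X ω ≤ t} = ∑ s ∈ Finset.range (t + 1), ρ.real {ω | X ω = s} := by
  have hset : {ω | X ω ≤ t} = ⋃ s ∈ Finset.range (t + 1), X ⁻¹' {s} := by
    ext ω
    simp
  rw [hset, measureReal_biUnion_finset]
  · rfl
  · intro s _ s' _ hss
    exact Set.disjoint_left.2 fun ω h h' => hss (h.symm.trans h')
  · exact fun s _ => hX (measurableSet_singleton s)

lemma geometric_measureReal_zero [IsProbabilityMeasure ρ] {X : Ω → ℕ} (hX : Measurable X) {β : ℝ}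
    (h0 : 0 ≤ β) (h1 : β < 1)
    (hlaw : ∀ t : ℕ, 1 ≤ t → ρ.real {ω | X ω = t} = β ^ (t - 1) * (1 - β)) :
    ρ.real {ω | X ω = 0} = 0 := by
  have hle : ∀ t : ℕ, ρ.real {ω | X ω = 0} ≤ β ^ t := by
    intro t
    have h := measureReal_le_eq_sum ρ hX t
    rw [Finset.sum_range_succ', Finset.sum_congr rfl fun s _ => hlaw (s + 1) (by omega)] at h
    simp only [Nat.add_sub_cancel] at h
    rw [← Finset.sum_mul, geom_sum_mul_neg] at h
    have : ρ.real {ω | X ω ≤ t} ≤ 1 := measureReal_le_one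
    linarith
  refine le_antisymm ?_ measureReal_nonneg
  exact ge_of_tendsto' (tendsto_pow_atTop_nhds_zero_of_lt_one h0 h1) hle

lemma geometric_add_measureReal_le_zero [IsProbabilityMeasure ρ] {X Y : Ω → ℕ}
    (hX : Measurable X) {β : ℝ} (h0 : 0 ≤ β) (h1 : β < 1)
    (hlaw : ∀ t : ℕ, 1 ≤ t → ρ.real {ω | X ω = t} = β ^ (t - 1) * (1 - β)) :
    ρ.real {ω | X ω + Y ω ≤ 0} = 0 := by
  refine le_antisymm ?_ measureReal_nonneg
  rw [← geometric_measureReal_zero ρ hX h0 h1 hlaw]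
  refine measureReal_mono fun ω hω => ?_
  simp only [Set.mem_ofPred_eq] at hω ⊢
  omega

/-- First-step recursion for the distribution function of a sum with a geometric summand. -/
lemma geometric_add_measureReal_le_succ [IsProbabilityMeasure ρ] {X Y : Ω → ℕ}
    (hX : Measurable X) (hY : Measurable Y) (hXY : IndepFun X Y ρ) {β : ℝ} (h0 : 0 ≤ β) (h1 : β < 1)
    (hlaw : ∀ t : ℕ, 1 ≤ t → ρ.real {ω | X ω = t} = β ^ (t - 1) * (1 - β)) (t : ℕ) :
    ρ.real {ω | X ω + Y ω ≤ t + 1} =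
      β * ρ.real {ω | X ω + Y ω ≤ t} + (1 - β) * ρ.real {ω | Y ω ≤ t} := by
  rw [measureReal_add_le_eq_sum ρ hX hY hXY, measureReal_add_le_eq_sum ρ hX hY hXY,
    Finset.sum_range_succ', Finset.sum_range_succ', Finset.sum_range_succ' _ t,
    geometric_measureReal_zero ρ hX h0 h1 hlaw, hlaw (0 + 1) (by omega), zero_mul, add_zero,
    zero_mul, add_zero, Finset.mul_sum]
  congr 1
  · refine Finset.sum_congr rfl fun s _ => ?_
    rw [hlaw (s + 1) (by omega), hlaw (s + 1 + 1) (by omega),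
      show t + 1 - (s + 1 + 1) = t - (s + 1) by omega]
    simp only [Nat.add_sub_cancel, pow_succ]
    ring
  · simp

/-- The recursion in `k` and `t` for the distribution functions of the tail sums
`∑_{j ≥ k} τ j` of independent geometric variables. -/
lemma geometric_tailSum_recursion [IsProbabilityMeasure ρ] {n : ℕ} {β : Fin n → ℝ}
    (hβ0 : ∀ j, 0 ≤ β j) (hβ1 : ∀ j, β j < 1) {τ : Fin n → Ω → ℕ} (hτmeas : ∀ j, Measurable (τ j))
    (hτindep : iIndepFun τ ρ)
    (hτlaw : ∀ j (t : ℕ), 1 ≤ t → ρ.real {ω | τ j ω = t} = β j ^ (t - 1) * (1 - β j))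
    (k : ℕ) (hk : k < n) :
    ρ.real {ω | ∑ j with k ≤ (j : Fin n).val, τ j ω ≤ 0} = 0 ∧
    ∀ t, ρ.real {ω | ∑ j with k ≤ (j : Fin n).val, τ j ω ≤ t + 1} =
      β ⟨k, hk⟩ * ρ.real {ω | ∑ j with k ≤ (j : Fin n).val, τ j ω ≤ t} +
      (1 - β ⟨k, hk⟩) * ρ.real {ω | ∑ j with k + 1 ≤ (j : Fin n).val, τ j ω ≤ t} := by
  set s : Finset (Fin n) := Finset.univ.filter fun j => k + 1 ≤ j.val with hs
  have hnot : (⟨k, hk⟩ : Fin n) ∉ s := by simp [hs]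
  have hins : (Finset.univ.filter fun j : Fin n => k ≤ j.val) = insert ⟨k, hk⟩ s := by
    ext j
    simp only [hs, Finset.mem_filter, Finset.mem_univ, true_and, Finset.mem_insert, Fin.ext_iff]
    omega
  have hsum : ∀ ω, ∑ j with k ≤ (j : Fin n).val, τ j ω = τ ⟨k, hk⟩ ω + ∑ j ∈ s, τ j ω := by
    intro ω
    rw [hins, Finset.sum_insert hnot]
  have hYm : Measurable fun ω => ∑ j ∈ s, τ j ω := Finset.measurable_sum _ fun j _ => hτmeas j
  have hind : IndepFun (τ ⟨k, hk⟩) (fun ω => ∑ j ∈ s, τ j ω) ρ := by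
    have := (hτindep.indepFun_finsetSum_of_notMem hτmeas hnot).symm
    convert this using 1
    ext ω
    simp
  simp only [hsum]
  exact ⟨geometric_add_measureReal_le_zero ρ (hτmeas _) (hβ0 _) (hβ1 _) (hτlaw _),
    geometric_add_measureReal_le_succ ρ (hτmeas _) hYm hind (hβ0 _) (hβ1 _) (hτlaw _)⟩

end Law

/-- Domination of the stationary distribution by the time-`t` distribution. -/
theorem measureReal_sum_le_mul_le_vecMul_pow {S : Type*} [Fintype S] [DecidableEq S]
    (n : ℕ) (hN : Fintype.card S = n + 1)
    (P : Matrix S S ℝ) (hP : P ∈ Matrix.rowStochastic ℝ S)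
    (hPcl : P ∈ closure (MarkovSep.reversibleClass S))
    (π : S → ℝ) (hπ : π ∈ stdSimplex ℝ S) (hrev : MarkovSep.IsReversible P π)
    (β : Fin n → ℝ) (hβmono : Monotone β) (hβ0 : ∀ j, 0 ≤ β j) (hβ1 : ∀ j, β j < 1)
    (hβ : P.charpoly =
      (Polynomial.X - Polynomial.C 1) * ∏ j, (Polynomial.X - Polynomial.C (β j)))
    {Ω : Type*} [MeasurableSpace Ω] (ρ : Measure Ω) [IsProbabilityMeasure ρ]
    (τ : Fin n → Ω → ℕ) (hτmeas : ∀ j, Measurable (τ j)) (hτindep : iIndepFun τ ρ)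
    (hτlaw : ∀ j (t : ℕ), 1 ≤ t → ρ.real {ω | τ j ω = t} = β j ^ (t - 1) * (1 - β j))
    (μ : S → ℝ) (hμ : μ ∈ stdSimplex ℝ S) (t : ℕ) (x : S) :
    ρ.real {ω | ∑ j, τ j ω ≤ t} * π x ≤ (μ ᵥ* P ^ t) x := by
  set b : ℕ → ℝ := fun k => if h : k < n then β ⟨k, h⟩ else 1 with hb
  have hbβ : ∀ k (h : k < n), b k = β ⟨k, h⟩ := fun k h => by simp [hb, h]
  have hb0 : ∀ k < n, 0 ≤ b k := fun k h => by rw [hbβ k h]; exact hβ0 _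
  have hb1 : ∀ k < n, b k < 1 := fun k h => by rw [hbβ k h]; exact hβ1 _
  have hbmono : ∀ i k, i ≤ k → k < Fintype.card S → b i ≤ b k := by
    intro i k hik _
    by_cases hk : k < n
    · rw [hbβ k hk, hbβ i (by omega)]
      exact hβmono (by simpa using hik)
    · have : b k = 1 := by simp [hb, hk]
      rw [this]
      by_cases hi : i < n
      · exact (hb1 i hi).le
      · simp [hb, hi]
  have hchar : P.charpoly = newtonPoly b n * (X - C 1) := by
    rw [hβ, mul_comm, newtonPoly, ← Fin.prod_univ_eq_prod_range (fun k => X - C (b k)) n]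
    congr 1
    exact Finset.prod_congr rfl fun j _ => by rw [hbβ j.val j.isLt]
  have hcharN : P.charpoly = newtonPoly b (Fintype.card S) := by
    rw [hchar, hN, newtonPoly_succ]
    simp [hb]
  have hπP := hrev.vecMul_eq hP
  have := le_linkDist_vecMul_pow (μ := μ) (n := n) hπP hb0 hb1
    (fun k hk => linkDist_nonneg hμ.1 (fun j hj => hb1 j (by omega))
      (aeval_newtonPoly_nonneg hPcl hbmono hcharN k (by omega)))
    (linkDist_eq_stationary hP hμ.2 hπ.2 hπP hb1 hchar)
    (fun k t => ρ.real {ω | ∑ j with k ≤ (j : Fin n).val, τ j ω ≤ t})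
    (fun t => by simp [Finset.filter_false_of_mem])
    (fun k hk => (geometric_tailSum_recursion ρ hβ0 hβ1 hτmeas hτindep hτlaw k hk).1)
    (fun k hk t => by
      rw [hbβ k hk]
      exact (geometric_tailSum_recursion ρ hβ0 hβ1 hτmeas hτindep hτlaw k hk).2 t)
    t 0 (Nat.zero_le n) x
  simpa [linkDist_zero] using this

/-- The measure on a finite type with given point masses. -/
noncomputable def pointMassMeasure {E : Type*} [Fintype E] [MeasurableSpace E] (p : E → ℝ) :
    Measure E :=
  ∑ z, ENNReal.ofReal (p z) • Measure.dirac z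

lemma pointMassMeasure_singleton {E : Type*} [Fintype E] [DecidableEq E] [MeasurableSpace E]
    [MeasurableSingletonClass E] (p : E → ℝ) (z : E) :
    pointMassMeasure p {z} = ENNReal.ofReal (p z) := by
  simp only [pointMassMeasure, Measure.coe_finsetSum, Finset.sum_apply, Measure.smul_apply,
    Measure.dirac_apply, smul_eq_mul]
  rw [Finset.sum_eq_single z]
  · simp
  · intro y _ hy
    simp [hy]
  · simp

lemma isProbabilityMeasure_pointMassMeasure {E : Type*} [Fintype E] [MeasurableSpace E]
    {p : E → ℝ} (hp : p ∈ stdSimplex ℝ E) : IsProbabilityMeasure (pointMassMeasure p) := by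
  constructor
  simp only [pointMassMeasure, Measure.coe_finsetSum, Finset.sum_apply, Measure.smul_apply,
    measure_univ, smul_eq_mul, mul_one]
  rw [← ENNReal.ofReal_sum_of_nonneg fun z _ => hp.1 z, hp.2, ENNReal.ofReal_one]

/-- Existence of a time-inhomogeneous Markov chain on a finite state space. -/
theorem exists_inhomogeneous_chain {E : Type} [Fintype E] [DecidableEq E] [MeasurableSpace E]
    [MeasurableSingletonClass E] (p : E → ℝ) (hp : p ∈ stdSimplex ℝ E) (K : ℕ → E → E → ℝ)
    (hK : ∀ t z, K t z ∈ stdSimplex ℝ E) :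
    ∃ ρ : Measure (ℕ → E), IsProbabilityMeasure ρ ∧ (∀ z, ρ.real {ω | ω 0 = z} = p z) ∧
      ∀ t z z' A, MeasurableSet[Filtration.piLE (X := fun _ : ℕ => E) t] A →
        ρ.real (A ∩ {ω | ω t = z ∧ ω (t + 1) = z'}) = ρ.real (A ∩ {ω | ω t = z}) * K t z z' := by
  let κ : (t : ℕ) → Kernel ((i : Finset.Iic t) → E) E := fun t =>
    Kernel.ofFunOfCountable fun h => pointMassMeasure (K t (h ⟨t, by simp⟩))
  have hκ : ∀ t h, κ t h = pointMassMeasure (K t (h ⟨t, by simp⟩)) := fun _ _ => rfl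
  have : ∀ t, IsMarkovKernel (κ t) := fun t =>
    ⟨fun h => isProbabilityMeasure_pointMassMeasure (hK t _)⟩
  have := isProbabilityMeasure_pointMassMeasure hp
  let ρ : Measure (ℕ → E) := Kernel.trajMeasure (X := fun _ => E) (pointMassMeasure p) κ
  have : IsProbabilityMeasure ρ := by unfold ρ; infer_instance
  refine ⟨ρ, inferInstance, fun z => ?_, fun t z z' A hA => ?_⟩
  · have h1 : ρ.map (Preorder.frestrictLe 0) =
        (pointMassMeasure p).map
          (MeasurableEquiv.piUnique (fun _ : Finset.Iic 0 => E)).symm := by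
      unfold ρ
      rw [Kernel.trajMeasure, Measure.map_comp _ _ (by fun_prop), Kernel.traj_map_frestrictLe,
        Kernel.partialTraj_self, Measure.id_comp]
    have h2 := congrArg (fun m : Measure ((i : Finset.Iic 0) → E) =>
      m {h | h ⟨0, by simp⟩ = z}) h1
    have hm : MeasurableSet {h : (i : Finset.Iic 0) → E | h ⟨0, by simp⟩ = z} :=
      (Set.toFinite _).measurableSet
    rw [Measure.map_apply (by fun_prop) hm, Measure.map_apply (by fun_prop) hm] at h2
    have h3 : (MeasurableEquiv.piUnique (fun _ : Finset.Iic 0 => E)).symm ⁻¹'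
        {h | h ⟨0, by simp⟩ = z} = {z} := by
      ext y
      rfl
    rw [h3, pointMassMeasure_singleton] at h2
    rw [measureReal_def]
    refine (congrArg ENNReal.toReal h2).trans ?_
    exact ENNReal.toReal_ofReal (hp.1 z)
  · rw [Filtration.piLE_eq_comap_frestrictLe] at hA
    obtain ⟨B, hB, rfl⟩ := hA
    set B' : Set ((i : Finset.Iic t) → E) := B ∩ {h | h ⟨t, by simp⟩ = z} with hB'
    have hB'm : MeasurableSet B' :=
      (Set.toFinite _).measurableSet
    have h1 := congrArg (fun m : Measure (((i : Finset.Iic t) → E) × E) => m (B' ×ˢ {z'}))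
      (Kernel.map_frestrictLe_trajMeasure_compProd_eq_map_trajMeasure (X := fun _ => E)
        (μ₀ := pointMassMeasure p) (κ := κ) (a := t))
    rw [Measure.compProd_apply_prod hB'm (measurableSet_singleton z'),
      Measure.map_apply (by fun_prop) (hB'm.prod (measurableSet_singleton z')),
      setLIntegral_congr_fun (g := fun _ => ENNReal.ofReal (K t z z')) hB'm (fun h hh => by
        simp only [hκ, pointMassMeasure_singleton]
        rw [show h ⟨t, by simp⟩ = z from hh.2]),
      setLIntegral_const, Measure.map_apply (by fun_prop) hB'm] at h1
    have e1 : Preorder.frestrictLe t ⁻¹' B ∩ {ω : ℕ → E | ω t = z ∧ ω (t + 1) = z'} =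
        (fun x : ℕ → E => (Preorder.frestrictLe (π := fun _ => E) t x, x (t + 1))) ⁻¹'
          (B' ×ˢ {z'}) := by
      ext ω
      simp [hB', and_assoc]
    have e2 : Preorder.frestrictLe t ⁻¹' B ∩ {ω : ℕ → E | ω t = z} =
        Preorder.frestrictLe (π := fun _ => E) t ⁻¹' B' := by
      ext ω
      simp [hB']
    rw [e1, e2, measureReal_def, measureReal_def, mul_comm, ← ENNReal.toReal_ofReal ((hK t z).1 z'),
      ← ENNReal.toReal_mul]
    exact (congrArg ENNReal.toReal h1).symm

lemma sum_measureReal_inter_eq {Ω E : Type*} [MeasurableSpace Ω] [Fintype E] (ρ : Measure Ω)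
    [IsFiniteMeasure ρ] {g : Ω → E} (hg : ∀ z, MeasurableSet {ω | g ω = z}) (A : Set Ω) :
    ∑ z, ρ.real (A ∩ {ω | g ω = z}) = ρ.real A := by
  have h := sum_measureReal_preimage_singleton (μ := ρ.restrict A) (f := g) Finset.univ
    (fun z _ => hg z)
  simp only [Finset.coe_univ, Set.preimage_univ, measureReal_restrict_apply_univ] at h
  rw [← h]
  refine Finset.sum_congr rfl fun z _ => ?_
  have hz : MeasurableSet (g ⁻¹' {z}) := hg z
  rw [measureReal_restrict_apply hz, Set.inter_comm]
  rfl

lemma measureReal_comap_subtype_preimage {Ω : Type*} [MeasurableSpace Ω] {ρ : Measure Ω}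
    {s : Set Ω} (hs : MeasurableSet s) (h0 : ρ sᶜ = 0) (A : Set Ω) :
    (ρ.comap (Subtype.val : s → Ω)).real (Subtype.val ⁻¹' A) = ρ.real A := by
  rw [measureReal_def, comap_subtype_coe_apply hs, Subtype.image_preimage_coe, Set.inter_comm,
    measure_inter_conull h0, measureReal_def]

/-- The filtration induced on a subspace. -/
def subtypeFiltration {Ω : Type*} {m : MeasurableSpace Ω} (ℱ : Filtration ℕ m) (s : Set Ω) :
    Filtration ℕ (inferInstance : MeasurableSpace s) where
  seq t := (ℱ t).comap Subtype.val
  mono' _ _ h := MeasurableSpace.comap_mono (ℱ.mono h)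
  le' t := MeasurableSpace.comap_mono (ℱ.le t)

/-- A discrete distribution function `F` with `F(t) π ≤ μ P^t` is that of a strong stationary
time. -/
theorem exists_strongStationaryTime {S : Type} [Fintype S] [DecidableEq S] (P : Matrix S S ℝ)
    (hP : P ∈ Matrix.rowStochastic ℝ S) (μ π : S → ℝ) (hμ : μ ∈ stdSimplex ℝ S)
    (hπ : π ∈ stdSimplex ℝ S) (hπP : ∀ y, ∑ x, π x * P x y = π y) (m : ℕ → S → ℝ) (hm0 : m 0 = μ)
    (hm : ∀ t y, m (t + 1) y = ∑ x, m t x * P x y) (f : ℕ → ℝ) (hf0 : ∀ t, 0 ≤ f t)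
    (hf1 : HasSum f 1) (hdom : ∀ t x, (∑ s ∈ Finset.range (t + 1), f s) * π x ≤ m t x) :
    ∃ (Ω' : Type) (_ : MeasurableSpace Ω') (ρ' : MeasureTheory.Measure Ω')
      (ℱ : MeasureTheory.Filtration ℕ (inferInstance : MeasurableSpace Ω'))
      (X : ℕ → Ω' → S) (T : Ω' → ℕ),
      MeasureTheory.IsProbabilityMeasure ρ' ∧
      MarkovSep.IsMarkovChain ρ' ℱ μ P X ∧
      MarkovSep.IsStrongStationaryTime ρ' ℱ π X T ∧
      ∀ t : ℕ, ρ'.real {ω | T ω = t} = f t := by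
  let _ : MeasurableSpace S := ⊤
  have : DiscreteMeasurableSpace S := ⟨fun _ => trivial⟩
  -- mass at `x` not stopped before time `t`, and the conditional probability of stopping there
  set u : ℕ → S → ℝ := fun t x => m t x - (∑ s ∈ Finset.range t, f s) * π x with hu
  set h : ℕ → S → ℝ := fun t x => f t * π x / u t x with hh
  have hfu : ∀ t x, f t * π x ≤ u t x := by
    intro t x
    have := hdom t x
    rw [Finset.sum_range_succ] at this
    simp only [hu]
    linarith
  have hfπ : ∀ t x, 0 ≤ f t * π x := fun t x => mul_nonneg (hf0 t) (hπ.1 x)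
  have hu0 : ∀ t x, 0 ≤ u t x := fun t x => (hfπ t x).trans (hfu t x)
  have hh0 : ∀ t x, 0 ≤ h t x := fun t x => div_nonneg (hfπ t x) (hu0 t x)
  have hh1 : ∀ t x, h t x ≤ 1 := fun t x => div_le_one_of_le₀ (hfu t x) (hu0 t x)
  have huh : ∀ t x, u t x * h t x = f t * π x := by
    intro t x
    rcases (hu0 t x).eq_or_lt with h0 | h0
    · rw [← h0, zero_mul]
      exact le_antisymm (hfπ t x) (h0 ▸ hfu t x)
    · exact mul_div_cancel₀ _ h0.ne'
  let g : ℕ → S → Bool → ℝ := fun t x c => if c then h t x else 1 - h t x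
  have hg0 : ∀ t x c, 0 ≤ g t x c := by
    intro t x c
    cases c
    · simpa [g] using hh1 t x
    · simpa [g] using hh0 t x
  have hgsum : ∀ t x, ∑ c, g t x c = 1 := by
    intro t x
    simp [g]
  let p : S × Bool → ℝ := fun z => μ z.1 * g 0 z.1 z.2
  let K : ℕ → S × Bool → S × Bool → ℝ := fun t z z' =>
    P z.1 z'.1 * (if z.2 then (if z'.2 then 1 else 0) else g (t + 1) z'.1 z'.2)
  have hKsum : ∀ t z y, ∑ c, K t z (y, c) = P z.1 y := by
    rintro t ⟨x, c⟩ y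
    simp only [K, ← Finset.mul_sum]
    cases c
    · simp only [Bool.false_eq_true, if_false, hgsum, mul_one]
    · simp
  have hp : p ∈ stdSimplex ℝ (S × Bool) := by
    refine ⟨fun z => mul_nonneg (hμ.1 _) (hg0 _ _ _), ?_⟩
    rw [Fintype.sum_prod_type]
    simp only [p, ← Finset.mul_sum, hgsum, mul_one]
    exact hμ.2
  have hK : ∀ t z, K t z ∈ stdSimplex ℝ (S × Bool) := by
    intro t z
    refine ⟨fun z' => mul_nonneg (hP.1 _ _) ?_, ?_⟩
    · split_ifs <;> simp [hg0]
    · rw [Fintype.sum_prod_type]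
      simp only [hKsum]
      exact sum_row_of_mem_rowStochastic hP _
  obtain ⟨ρ, hρ, hinit, hmark⟩ := exists_inhomogeneous_chain p hp K hK
  set 𝒢 : Filtration ℕ (inferInstance : MeasurableSpace (ℕ → S × Bool)) :=
    Filtration.piLE (X := fun _ : ℕ => S × Bool) with h𝒢
  have hcoord : ∀ t s : ℕ, s ≤ t → ∀ q : S × Bool → Prop,
      MeasurableSet[𝒢 t] {ω : ℕ → S × Bool | q (ω s)} := by
    intro t s hst q
    rw [h𝒢, Filtration.piLE_eq_comap_frestrictLe]
    refine ⟨{k | q (k ⟨s, by simpa using hst⟩)}, (Set.toFinite _).measurableSet, rfl⟩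
  have hcoord' : ∀ s (q : S × Bool → Prop), MeasurableSet {ω : ℕ → S × Bool | q (ω s)} :=
    fun s q => 𝒢.le s _ (hcoord s s le_rfl q)
  -- the event of not stopping before time `t`
  let V : ℕ → Set (ℕ → S × Bool) := fun t => {ω | ∀ s < t, (ω s).2 = false}
  have hV : ∀ t s, s ≤ t + 1 → MeasurableSet[𝒢 t] (V s) := by
    intro t s hst
    have : V s = ⋂ r, ⋂ (_ : r < s), {ω : ℕ → S × Bool | (ω r).2 = false} := by
      ext ω; simp [V]
    rw [this]
    exact MeasurableSet.iInter fun r => MeasurableSet.iInter fun hr =>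
      hcoord t r (by omega) (fun z => z.2 = false)
  have hVmass : ∀ t y c, ρ.real (V t ∩ {ω | ω t = (y, c)}) = u t y * g t y c := by
    intro t
    induction t with
    | zero =>
      intro y c
      have : V 0 = Set.univ := by ext ω; simp [V]
      rw [this, Set.univ_inter, hinit]
      simp [p, hu, hm0]
    | succ t ih =>
      intro y c
      have hVs : ∀ z : S × Bool, ρ.real ((V (t + 1) ∩ {ω | ω (t + 1) = (y, c)}) ∩ {ω | ω t = z}) =
          if z.2 = true then 0 else u t z.1 * g t z.1 false * K t z (y, c) := by
        rintro ⟨x, d⟩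
        cases d
        · have hset : (V (t + 1) ∩ {ω | ω (t + 1) = (y, c)}) ∩ {ω | ω t = (x, false)} =
              V t ∩ {ω | ω t = (x, false) ∧ ω (t + 1) = (y, c)} := by
            ext ω
            simp only [V, Set.mem_inter_iff, Set.mem_ofPred_eq]
            constructor
            · rintro ⟨⟨h1, h2⟩, h3⟩
              exact ⟨fun s hs => h1 s (by omega), h3, h2⟩
            · rintro ⟨h1, h3, h2⟩
              refine ⟨⟨fun s hs => ?_, h2⟩, h3⟩
              rcases Nat.lt_succ_iff_lt_or_eq.1 hs with hs | rfl
              · exact h1 s hs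
              · rw [h3]
          rw [hset, hmark t _ _ _ (hV t t (by omega)), ih]
          simp
        · have hset : (V (t + 1) ∩ {ω | ω (t + 1) = (y, c)}) ∩ {ω | ω t = (x, true)} = ∅ := by
            ext ω
            simp only [V, Set.mem_inter_iff, Set.mem_ofPred_eq, Set.mem_empty_iff_false, iff_false]
            rintro ⟨⟨h1, -⟩, h3⟩
            have := h1 t (by omega)
            rw [h3] at this
            simp at this
          rw [hset]
          simp
      rw [← sum_measureReal_inter_eq ρ (g := fun ω => ω t) (fun z => hcoord' t (fun w => w = z)),
        Finset.sum_congr rfl fun z _ => hVs z, Fintype.sum_prod_type]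
      simp only [Fintype.sum_bool, if_true, Bool.false_eq_true, if_false, zero_add, K]
      have h1 : ∀ x, u t x * g t x false = m t x - (∑ s ∈ Finset.range (t + 1), f s) * π x := by
        intro x
        have := huh t x
        simp only [g, Bool.false_eq_true, if_false, mul_sub, mul_one, this]
        simp only [Finset.sum_range_succ, hu]
        ring
      simp only [h1, ← mul_assoc, ← Finset.sum_mul]
      congr 1
      simp only [sub_mul, Finset.sum_sub_distrib, hu, hm, mul_assoc, ← Finset.mul_sum, hπP]
  have hmsum : ∀ t, ∑ x, m t x = 1 := by
    intro t
    induction t with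
    | zero => rw [hm0]; exact hμ.2
    | succ t ih =>
      simp only [hm]
      rw [Finset.sum_comm]
      simp only [← Finset.mul_sum, sum_row_of_mem_rowStochastic hP, mul_one, ih]
  have hVreal : ∀ t, ρ.real (V t) = 1 - ∑ s ∈ Finset.range t, f s := by
    intro t
    rw [← sum_measureReal_inter_eq ρ (g := fun ω => ω t) (fun z => hcoord' t (fun w => w = z)),
      Fintype.sum_prod_type]
    simp only [hVmass, ← Finset.mul_sum, hgsum, mul_one, hu, Finset.sum_sub_distrib, hmsum, hπ.2]
  -- restriction to the almost sure event of stopping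
  set G : Set (ℕ → S × Bool) := {ω | ∃ t, (ω t).2 = true} with hG
  have hGm : MeasurableSet G := by
    have : G = ⋃ t, {ω : ℕ → S × Bool | (ω t).2 = true} := by ext ω; simp [hG]
    rw [this]
    exact MeasurableSet.iUnion fun t => hcoord' t fun z => z.2 = true
  have hGc : ρ Gᶜ = 0 := by
    have hle : ∀ t, ρ.real Gᶜ ≤ 1 - ∑ s ∈ Finset.range t, f s := by
      intro t
      rw [← hVreal]
      refine measureReal_mono fun ω hω s _ => ?_
      simp only [hG, Set.mem_compl_iff, Set.mem_ofPred_eq, not_exists, Bool.not_eq_true] at hω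
      exact hω s
    have hlim := (hf1.tendsto_sum_nat.const_sub 1)
    rw [sub_self] at hlim
    exact (measureReal_eq_zero_iff).1 (le_antisymm (ge_of_tendsto' hlim hle) measureReal_nonneg)
  have hreal := measureReal_comap_subtype_preimage hGm hGc
  let X : ℕ → G → S := fun t ω => (ω.1 t).1
  let T : G → ℕ := fun ω => Nat.find ω.2
  have hT : ∀ (ω : G) t, T ω = t ↔ (ω.1 t).2 = true ∧ ω.1 ∈ V t := by
    intro ω t
    simp [T, V, Nat.find_eq_iff]
  have hTx : ∀ t x, {ω : G | X (T ω) ω = x ∧ T ω = t} =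
      Subtype.val ⁻¹' (V t ∩ {ω | ω t = (x, true)}) := by
    intro t x
    ext ω
    simp only [Set.mem_ofPred_eq, Set.mem_preimage, Set.mem_inter_iff]
    constructor
    · rintro ⟨h1, h2⟩
      obtain ⟨h3, h4⟩ := (hT ω t).1 h2
      rw [h2] at h1
      exact ⟨h4, Prod.ext h1 h3⟩
    · rintro ⟨h1, h2⟩
      have h3 : T ω = t := (hT ω t).2 ⟨by rw [h2], h1⟩
      exact ⟨by rw [h3]; simp [X, h2], h3⟩
  have hTt : ∀ t, {ω : G | T ω = t} = Subtype.val ⁻¹' (V t ∩ {ω | (ω t).2 = true}) := by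
    intro t
    ext ω
    simp only [Set.mem_ofPred_eq, Set.mem_preimage, Set.mem_inter_iff, hT]
    exact and_comm
  have hmass : ∀ t x, ρ.real (V t ∩ {ω | ω t = (x, true)}) = f t * π x := by
    intro t x
    rw [hVmass]
    simpa [g] using huh t x
  have hTlaw : ∀ t, (ρ.comap (Subtype.val : G → _)).real {ω | T ω = t} = f t := by
    intro t
    rw [hTt, hreal, ← sum_measureReal_inter_eq ρ (g := fun ω => (ω t).1)
      (fun x => hcoord' t (fun w => w.1 = x))]
    have : ∀ x, V t ∩ {ω | (ω t).2 = true} ∩ {ω | (ω t).1 = x} = V t ∩ {ω | ω t = (x, true)} := by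
      intro x
      ext ω
      simp only [Set.mem_inter_iff, Set.mem_ofPred_eq, Prod.ext_iff]
      tauto
    simp only [this, hmass, ← Finset.mul_sum, hπ.2, mul_one]
  refine ⟨G, inferInstance, ρ.comap Subtype.val, subtypeFiltration 𝒢 G, X, T, ?_, ?_, ?_, hTlaw⟩
  · constructor
    rw [comap_subtype_coe_apply hGm, Set.image_univ, Subtype.range_coe]
    exact (prob_compl_eq_zero_iff hGm).1 hGc
  · refine ⟨fun t x => ⟨{ω | (ω t).1 = x}, hcoord t t le_rfl (fun w => w.1 = x), rfl⟩,
      fun x => ?_, ?_⟩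
    · rw [show {ω : G | X 0 ω = x} = Subtype.val ⁻¹' {ω | (ω 0).1 = x} from rfl, hreal,
        ← sum_measureReal_inter_eq ρ (g := fun ω => (ω 0).2) (fun c => hcoord' 0 (fun w => w.2 = c))]
      have : ∀ c, {ω : ℕ → S × Bool | (ω 0).1 = x} ∩ {ω | (ω 0).2 = c} = {ω | ω 0 = (x, c)} := by
        intro c
        ext ω
        simp [Prod.ext_iff]
      simp only [this, hinit, p, ← Finset.mul_sum, hgsum, mul_one]
    · rintro t x y _ ⟨A, hA, rfl⟩
      rw [show {ω : G | X t ω = x ∧ X (t + 1) ω = y} =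
          Subtype.val ⁻¹' {ω | (ω t).1 = x ∧ (ω (t + 1)).1 = y} from rfl,
        show {ω : G | X t ω = x} = Subtype.val ⁻¹' {ω | (ω t).1 = x} from rfl,
        ← Set.preimage_inter, ← Set.preimage_inter, hreal, hreal,
        ← sum_measureReal_inter_eq ρ (g := fun ω => (ω t).2) (fun c => hcoord' t (fun w => w.2 = c)),
        ← sum_measureReal_inter_eq ρ (g := fun ω => (ω t).2) (fun c => hcoord' t (fun w => w.2 = c))
          (A ∩ {ω | (ω t).1 = x}), Finset.sum_mul]
      refine Finset.sum_congr rfl fun c _ => ?_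
      rw [← sum_measureReal_inter_eq ρ (g := fun ω => (ω (t + 1)).2)
        (fun c => hcoord' (t + 1) (fun w => w.2 = c))]
      have e1 : ∀ d, A ∩ {ω | (ω t).1 = x ∧ (ω (t + 1)).1 = y} ∩ {ω | (ω t).2 = c} ∩
          {ω | (ω (t + 1)).2 = d} = A ∩ {ω | ω t = (x, c) ∧ ω (t + 1) = (y, d)} := by
        intro d
        ext ω
        simp only [Set.mem_inter_iff, Set.mem_ofPred_eq, Prod.ext_iff]
        tauto
      have e2 : A ∩ {ω | (ω t).1 = x} ∩ {ω | (ω t).2 = c} = A ∩ {ω | ω t = (x, c)} := by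
        ext ω
        simp only [Set.mem_inter_iff, Set.mem_ofPred_eq, Prod.ext_iff]
        tauto
      simp only [e1, e2, hmark t _ _ A hA, ← Finset.mul_sum, hKsum]
  · refine ⟨fun t => ?_, fun t x => ?_⟩
    · refine ⟨(V (t + 1))ᶜ, (hV t (t + 1) le_rfl).compl, ?_⟩
      ext ω
      simp [V, T, Nat.find_le_iff]
    · rw [hTx, hreal, hmass, hTlaw, mul_comm]

lemma hasSum_measureReal_eq {Ω : Type*} [MeasurableSpace Ω] (ρ : Measure Ω)
    [IsProbabilityMeasure ρ] {Z : Ω → ℕ} (hZ : Measurable Z) :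
    HasSum (fun t : ℕ => ρ.real {ω | Z ω = t}) 1 := by
  have h1 : ∑' t : ℕ, ρ (Z ⁻¹' {t}) = 1 := by
    rw [← measure_iUnion]
    · rw [← Set.preimage_iUnion, Set.iUnion_of_singleton, Set.preimage_univ, measure_univ]
    · intro s s' hss
      exact Set.disjoint_left.2 fun ω h h' => hss (h.symm.trans h')
    · exact fun t => hZ (measurableSet_singleton t)
  have h2 := ENNReal.hasSum_toReal (f := fun t : ℕ => ρ (Z ⁻¹' {t})) (by simp [h1])
  rwa [← ENNReal.tsum_toReal_eq (fun t => measure_ne_top _ _), h1, ENNReal.toReal_one] at h2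

lemma dsep_le_of_mul_le {S : Type*} [Fintype S] {μ π : S → ℝ} (hπ : π ∈ stdSimplex ℝ S) {c : ℝ}
    (h : ∀ x, c * π x ≤ μ x) : MarkovSep.dsep μ π ≤ 1 - c := by
  have : Nonempty {x : S // π x ≠ 0} := by
    by_contra hne
    rw [not_nonempty_iff, isEmpty_subtype] at hne
    have h1 := hπ.2
    simp only [not_not] at hne
    simp [hne] at h1
  refine ciSup_le fun x => ?_
  have hpos : 0 < π x := lt_of_le_of_ne (hπ.1 x) (Ne.symm x.2)
  have := (le_div_iff₀ hpos).2 (h x)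
  linarith

/-- `exists_strongStationaryTime` for a state space in an arbitrary universe. -/
theorem exists_strongStationaryTime_of_le_vecMul_pow {S : Type*} [Fintype S] [DecidableEq S]
    (P : Matrix S S ℝ) (hP : P ∈ Matrix.rowStochastic ℝ S) (μ π : S → ℝ) (hμ : μ ∈ stdSimplex ℝ S)
    (hπ : π ∈ stdSimplex ℝ S) (hπP : π ᵥ* P = π) (f : ℕ → ℝ) (hf0 : ∀ t, 0 ≤ f t)
    (hf1 : HasSum f 1)
    (hdom : ∀ t x, (∑ s ∈ Finset.range (t + 1), f s) * π x ≤ (μ ᵥ* P ^ t) x) :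
    ∃ (Ω' : Type) (_ : MeasurableSpace Ω') (ρ' : MeasureTheory.Measure Ω')
      (ℱ : MeasureTheory.Filtration ℕ (inferInstance : MeasurableSpace Ω'))
      (X : ℕ → Ω' → S) (T : Ω' → ℕ),
      MeasureTheory.IsProbabilityMeasure ρ' ∧
      MarkovSep.IsMarkovChain ρ' ℱ μ P X ∧
      MarkovSep.IsStrongStationaryTime ρ' ℱ π X T ∧
      ∀ t : ℕ, ρ'.real {ω | T ω = t} = f t := by
  let e : Fin (Fintype.card S) ≃ S := (Fintype.equivFin S).symm
  have hsimplex : ∀ q ∈ stdSimplex ℝ S, (fun i => q (e i)) ∈ stdSimplex ℝ (Fin (Fintype.card S)) :=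
    fun q hq => ⟨fun i => hq.1 _, (Equiv.sum_comp e q).trans hq.2⟩
  obtain ⟨Ω', mΩ, ρ', ℱ, X, T, hρ', hX, hT, hlaw⟩ := exists_strongStationaryTime
    (P.submatrix e e)
    (mem_rowStochastic_iff_sum.2 ⟨fun i j => hP.1 _ _, fun i =>
      (Equiv.sum_comp e fun y => P (e i) y).trans (sum_row_of_mem_rowStochastic hP _)⟩)
    (fun i => μ (e i)) (fun i => π (e i)) (hsimplex μ hμ) (hsimplex π hπ)
    (fun j => (Equiv.sum_comp e fun x => π x * P x (e j)).trans (congrFun hπP (e j)))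
    (fun t i => (μ ᵥ* P ^ t) (e i)) (by simp)
    (fun t j => by
      rw [pow_succ, ← vecMul_vecMul]
      exact (Equiv.sum_comp e fun x => (μ ᵥ* P ^ t) x * P x (e j)).symm)
    f hf0 hf1 (fun t i => hdom t (e i))
  have hev : ∀ (i : Fin (Fintype.card S)) (x : S), e i = x ↔ i = e.symm x :=
    fun i x => e.eq_symm_apply.symm
  refine ⟨Ω', mΩ, ρ', ℱ, fun t ω => e (X t ω), T, hρ', ⟨fun t x => ?_, fun x => ?_, ?_⟩,
    ⟨hT.stopping, fun t x => ?_⟩, hlaw⟩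
  · simpa only [hev] using hX.adapted t (e.symm x)
  · simpa [hev] using hX.initial (e.symm x)
  · intro t x y A hA
    simpa [hev] using hX.markov t (e.symm x) (e.symm y) A hA
  · simpa [hev] using hT.stationary t (e.symm x)

end

theorem theorem1p4 {S : Type*} [Fintype S] [DecidableEq S]
    -- the state space has `N = n + 1` elements
    (n : ℕ) (hN : Fintype.card S = n + 1)
    (P : Matrix S S ℝ) (hP : P ∈ Matrix.rowStochastic ℝ S)
    (hPcl : P ∈ closure (MarkovSep.reversibleClass S))
    (π : S → ℝ) (hπ : π ∈ stdSimplex ℝ S) (hrev : MarkovSep.IsReversible P π)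
    -- the eigenvalues of `P`, with algebraic multiplicity, are `1` and the `β j`
    (β : Fin n → ℝ) (hβmono : Monotone β) (hβ0 : ∀ j, 0 ≤ β j) (hβ1 : ∀ j, β j < 1)
    (hβ : P.charpoly =
      (Polynomial.X - Polynomial.C 1) * ∏ j, (Polynomial.X - Polynomial.C (β j)))
    -- independent geometric random variables with success probabilities `1 - β j`
    {Ω : Type*} [MeasurableSpace Ω] (ρ : MeasureTheory.Measure Ω)
    [MeasureTheory.IsProbabilityMeasure ρ]
    (τ : Fin n → Ω → ℕ) (hτmeas : ∀ j, Measurable (τ j))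
    (hτindep : ProbabilityTheory.iIndepFun τ ρ)
    (hτlaw : ∀ j (t : ℕ), 1 ≤ t → ρ.real {ω | τ j ω = t} = β j ^ (t - 1) * (1 - β j))
    (μ : S → ℝ) (hμ : μ ∈ stdSimplex ℝ S) :
    (∀ t : ℕ, MarkovSep.dsep (Matrix.vecMul μ (P ^ t)) π ≤ ρ.real {ω | t < ∑ j, τ j ω}) ∧
    ∃ (Ω' : Type) (_ : MeasurableSpace Ω') (ρ' : MeasureTheory.Measure Ω')
      (ℱ : MeasureTheory.Filtration ℕ (inferInstance : MeasurableSpace Ω'))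
      (X : ℕ → Ω' → S) (T : Ω' → ℕ),
      MeasureTheory.IsProbabilityMeasure ρ' ∧
      MarkovSep.IsMarkovChain ρ' ℱ μ P X ∧
      MarkovSep.IsStrongStationaryTime ρ' ℱ π X T ∧
      ∀ t : ℕ, ρ'.real {ω | T ω = t} = ρ.real {ω | ∑ j, τ j ω = t} := by
  have hZ : Measurable fun ω => ∑ j, τ j ω := Finset.measurable_sum _ fun j _ => hτmeas j
  have hdom := measureReal_sum_le_mul_le_vecMul_pow n hN P hP hPcl π hπ hrev β hβmono hβ0 hβ1 hβ
    ρ τ hτmeas hτindep hτlaw μ hμ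
  refine ⟨fun t => ?_, ?_⟩
  · have hcompl : {ω | t < ∑ j, τ j ω} = {ω | ∑ j, τ j ω ≤ t}ᶜ := by
      ext ω
      simp
    have hmeas : MeasurableSet {ω | ∑ j, τ j ω ≤ t} := hZ measurableSet_Iic
    rw [hcompl, MeasureTheory.probReal_compl_eq_one_sub hmeas]
    exact dsep_le_of_mul_le hπ (hdom t)
  · refine exists_strongStationaryTime_of_le_vecMul_pow P hP μ π hμ hπ (hrev.vecMul_eq hP) _
      (fun _ => MeasureTheory.measureReal_nonneg) (hasSum_measureReal_eq ρ hZ) fun t x => ?_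
    rw [← measureReal_le_eq_sum ρ hZ]
    exact hdom t x
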